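/- Consider, for each $N\ge 1$, a network of $N$ secondary users. Let $h_1,\dots,h_N$ (gains from the users to the secondary base station) be i.i.d. with CDF $F_h$, let $g_1,\dots,g_N$ (gains from the users to the primary base station) be i.i.d. with CDF $F_g$, and let the vectors $\mathbf h=(h_1,\dots,h_N)$ and $\mathbf g=(g_1,\dots,g_N)$ be independent. Assume that $F_h$ and $F_g$ both belong to class $\mathcal C$, where a CDF $F$ belongs to class $\mathcal C$ if (i) $F$ is continuous; (ii) $F(x)=0$ for $x\le 0$; (iii) $F(x_1)<F(x_2)$ for $0<x_1<x_2$; (iv) there are constants $\alpha,\beta,n>0$, $l\in\mathbb R$ and a function $H$ with $H(x)=o(x^n)$ as $x\to\infty$ such that $$\lim_{x\to\infty}\frac{1-F(x)}{\alpha x^{l}\exp(-\beta x^{n}+H(x))}=1;$$ (v) there are constants $\eta,\gamma>0$ such that $\lim_{x\downarrow 0}\frac{F(x)}{\eta x^{\gamma}}=1$. Let $\eta_g$ and $\gamma_g$ be the constants in (v) for $F=F_g$. Fix $Q_{\rm ave}>0$. Let the full-feedback sum-rate $R^{\rm F}_{\rm IL}(N)$ of the interference-limited network be the supremum of $$\mathbb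 E\left[\log\left(1+\sum_{i=1}^N h_iP_i(\mathbf h,\mathbf g)\right)\right]$$ over all measurable power allocation policies $P=(P_1,\dots,P_N)$ with $P_i(\mathbf h,\mathbf g)\ge 0$ and $\mathbb E\left[\sum_{i=1}^N g_iP_i(\mathbf h,\mathbf g)\right]\le Q_{\rm ave}$. For $1\le K\le N$, let the $K$-SCG sum-rate $R^{K}_{\rm IL}(N,K)$ be the same supremum restricted to the policies that also satisfy the feedback constraint: $P_i(\mathbf h,\mathbf g)=0$ whenever $g_i>g_{K:N}$, where $g_{K:N}$ is the $K$-th smallest of $g_1,\dots,g_N$. Then, for every sequence of integers $(K_N)_{N\ge1}$ with $0<K_N\le N$ for all $N\ge 1$ (for example $K_N=1$ for all $N$), the sum-rates $R^{\rm F}_{\rm IL}(N)$ and $R^{K}_{\rm IL}(N,K_N)$ are finite for every $N$, and $$\lim_{N\to\infty}\frac{R^{\rm F}_{\rm IL}(N)}{\log N}=\lim_{N\to\infty}\frac{R^{K}_{\rm IL}(N,K_N)}{\log N}=\frac1{\gamma_g}.$$ -/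

import Mathlib

open MeasureTheory ProbabilityTheory Filter Topology
open scoped ENNReal

/-- `F` varies regularly around the origin with exponent `γ` and constant `η`:
`F x / (η x ^ γ) → 1` as `x ↓ 0`, where `η, γ > 0`. -/
def VariesRegularlyAtZero (F : ℝ → ℝ) (η γ : ℝ) : Prop :=
  0 < η ∧ 0 < γ ∧ Tendsto (fun x : ℝ => F x / (η * x ^ γ)) (𝓝[>] 0) (𝓝 1)

/-- The tail of `F` decays double exponentially:
`(1 - F x) / (α x ^ l exp (-β x ^ n + H x)) → 1` as `x → ∞`, where `α, β, n > 0`, `l` is real and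
`H x = o(x ^ n)`. The only restriction on the growth of the correction `H` is `H x = o(x ^ n)`;
this allows for instance `H = 0` (Rayleigh) and `H x = c * √x` with `n = 1` (Rician). -/
def HasDoubleExponentialTail (F : ℝ → ℝ) : Prop :=
  ∃ (α β n l : ℝ) (H : ℝ → ℝ), 0 < α ∧ 0 < β ∧ 0 < n ∧
    H =o[atTop] (fun x : ℝ => x ^ n) ∧
    Tendsto (fun x : ℝ => (1 - F x) / (α * x ^ l * Real.exp (-β * x ^ n + H x))) atTop (𝓝 1)

/-- A cumulative distribution function `F` belongs to the class-`C` distributions. -/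
structure IsClassC (F : ℝ → ℝ) : Prop where
  continuous : Continuous F
  eq_zero : ∀ x ≤ 0, F x = 0
  strictMonoOn : StrictMonoOn F (Set.Ioi 0)
  tail : HasDoubleExponentialTail F
  origin : ∃ η γ : ℝ, VariesRegularlyAtZero F η γ

/-- The joint law of the gain vectors `(h, g)` of an `N`-user network: the `h i` are i.i.d. with
law `νh`, the `g i` are i.i.d. with law `νg`, and the vectors `h` and `g` are independent. -/
noncomputable def channelLaw (νh νg : Measure ℝ) (N : ℕ) :
    Measure ((Fin N → ℝ) × (Fin N → ℝ)) :=
  (Measure.pi fun _ => νh).prod (Measure.pi fun _ => νg)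

/-- A power allocation policy: the transmit powers of the `N` users as a function of `(h, g)`. -/
abbrev PowerPolicy (N : ℕ) : Type := (Fin N → ℝ) × (Fin N → ℝ) → Fin N → ℝ

/-- The expected rate `E[log (1 + hᵀ P(h, g))]` of the policy `P` (in nats, unit noise variance). -/
noncomputable def expectedRate (νh νg : Measure ℝ) {N : ℕ} (P : PowerPolicy N) : ℝ≥0∞ :=
  ∫⁻ ω, ENNReal.ofReal (Real.log (1 + ∑ i, ω.1 i * P ω i)) ∂(channelLaw νh νg N)

/-- The average total interference power `E[gᵀ P(h, g)]` at the primary base station. -/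
noncomputable def avgInterference (νh νg : Measure ℝ) {N : ℕ} (P : PowerPolicy N) : ℝ≥0∞ :=
  ∫⁻ ω, ENNReal.ofReal (∑ i, ω.2 i * P ω i) ∂(channelLaw νh νg N)

/-- The policies admissible in an interference-limited network: measurable, nonnegative, and of
average total interference power at most `Q`. -/
structure IsILFeasible (νh νg : Measure ℝ) (Q : ℝ) {N : ℕ} (P : PowerPolicy N) : Prop where
  measurable : Measurable P
  nonneg : ∀ ω i, 0 ≤ P ω i
  interference : avgInterference νh νg P ≤ ENNReal.ofReal Q

/-- The `K`-th smallest of the numbers `g 0, …, g (N - 1)`, for `1 ≤ K ≤ N`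
(outside this range of `K` the value is irrelevant). -/
noncomputable def kthSmallest {N : ℕ} (g : Fin N → ℝ) (K : ℕ) : ℝ :=
  if hK : K - 1 < N then g (Tuple.sort g ⟨K - 1, hK⟩) else 0

/-- The feedback constraint: a user whose gain `g i` is not among the `K` smallest ones is
silent. -/
def SatisfiesFeedback (K : ℕ) {N : ℕ} (P : PowerPolicy N) : Prop :=
  ∀ ω i, kthSmallest ω.2 K < ω.2 i → P ω i = 0

/-- The sum-rate of the `N`-user interference-limited network with full feedback: the optimal value
of the power allocation problem. -/
noncomputable def sumRateFull (νh νg : Measure ℝ) (Q : ℝ) (N : ℕ) : ℝ≥0∞ :=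
  ⨆ (P : PowerPolicy N) (_ : IsILFeasible νh νg Q P), expectedRate νh νg P

/-- The sum-rate of the `N`-user interference-limited network when only the `K` smallest `g i` are
fed back: the optimal value of the power allocation problem with the feedback constraint. -/
noncomputable def sumRateKSCG (νh νg : Measure ℝ) (Q : ℝ) (N K : ℕ) : ℝ≥0∞ :=
  ⨆ (P : PowerPolicy N) (_ : IsILFeasible νh νg Q P ∧ SatisfiesFeedback K P), expectedRate νh νg P

/-!
Write `γ` for the exponent of the CDF of the gains `g i` at the origin. The sum-rate grows like
`log` of the largest ratio `h i / g i`, which is of order `N ^ (1 / γ)` because the smallest of `N`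
independent `g i` is of order `N ^ (-1 / γ)` while the gains `h i` have light tails.

*Upper bound.* For `0 < s < γ` put `W = 1 + ∑ i, (h i / g i) ^ s` and `S = ∑ i, g i * P i`. Every
`h i` is at most `W ^ (1 / s) * g i`, so `1 + ∑ i, h i * P i ≤ W ^ (1 / s) * (1 + S)` and the rate
is at most `s⁻¹ * log W + S` (`log_one_add_sum_le`). The mean of `S` is at most `Q`, and that of
`W` is at most `1 + N * M` with `M = E[h ^ s] * E[g ^ (-s)]`. Here `M` is finite: the double
exponential tail gives `h` all positive moments (`IsClassC.lintegral_rpow_lt_top`), and regular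
variation at the origin gives `g` the moment of order `-s` (`lintegral_inv_rpow_lt_top`). The tangent
bound `log W ≤ log (N + 1) + W / (N + 1)` takes the place of Jensen's inequality, and yields
`sumRateFull ≤ s⁻¹ * (log (N + 1) + C) + Q` with `C` independent of `N`
(`exists_sumRateFull_le`). Finally `s` tends to `γ`.

*Lower bound.* Spending the whole budget `Q` on the user with the smallest `g i`
(`minGainPolicy`) is admissible for every feedback level `K`, and uses no information on `h`. For
`c, t > 0` its rate is at least `log (1 + Q * c / t)` on the event that this user has `h i > c` and
`g i ≤ t`. By independence this event has probability `P(h > c) * (1 - P(g > t) ^ N)`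
(`le_sumRateKSCG`). With `t = N ^ (-a)` and `a < 1 / γ` the last factor tends to `1`
(`tendsto_one_sub_cdf_rpow_pow`), so the rate over `log N` is asymptotically at least
`a * P(h > c)`, and `a` and `P(h > c)` can be taken as close to `1 / γ` and `1` as desired.
-/

/-! ### Moments of the gains -/

/-- A nonnegative random variable whose tail is eventually at most `C * t ^ (-m)` has finite moments
of every order `s ∈ (0, m)`, by the layer cake formula. -/
theorem lintegral_rpow_lt_top_of_tail {Ω : Type*} [MeasurableSpace Ω] (μ : Measure Ω)
    [IsProbabilityMeasure μ] {f : Ω → ℝ} (hf : AEMeasurable f μ) (hf0 : 0 ≤ᵐ[μ] f)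
    {s m C : ℝ} (hs : 0 < s) (hsm : s < m)
    (htail : ∀ᶠ t in atTop, μ.real {x | t < f x} ≤ C * t ^ (-m)) :
    ∫⁻ x, ENNReal.ofReal (f x ^ s) ∂μ < ∞ := by
  rw [lintegral_rpow_eq_lintegral_meas_lt_mul μ hf0 hf hs]
  refine ENNReal.mul_lt_top ENNReal.ofReal_lt_top ?_
  obtain ⟨T₀, hT₀⟩ := eventually_atTop.1 htail
  set T := max T₀ 1
  have hT : 0 < T := lt_of_lt_of_le one_pos (le_max_right _ _)
  -- On `(0, T]` the tail is at most `1`; on `(T, ∞)` the assumed bound applies.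
  rw [← Set.Ioc_union_Ioi_eq_Ioi hT.le]
  refine (lintegral_union_le _ _ _).trans_lt (ENNReal.add_lt_top.2 ⟨?_, ?_⟩)
  · have hint : IntegrableOn (fun t : ℝ => t ^ (s - 1)) (Set.Ioc 0 T) :=
      (intervalIntegrable_iff_integrableOn_Ioc_of_le hT.le).1
        (intervalIntegral.intervalIntegrable_rpow' (by linarith))
    refine lt_of_le_of_lt (lintegral_mono fun t => ?_) hint.lintegral_lt_top
    exact mul_le_of_le_one_left' prob_le_one
  · have hint : IntegrableOn (fun t : ℝ => C * t ^ (-m + (s - 1))) (Set.Ioi T) :=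
      (integrableOn_Ioi_rpow_of_lt (by linarith) hT).const_mul C
    refine lt_of_le_of_lt (setLIntegral_mono' measurableSet_Ioi fun t ht => ?_)
      hint.lintegral_lt_top
    have ht' : T < t := ht
    have h0 : 0 < t := hT.trans ht'
    rw [Real.rpow_add h0, ← mul_assoc, ENNReal.ofReal_mul' (by positivity)]
    gcongr
    rw [← ofReal_measureReal]
    exact ENNReal.ofReal_le_ofReal (hT₀ t ((le_max_left _ _).trans ht'.le))

/-- A double exponential tail decays faster than every power: the correction `H` eventually uses up
at most half of the exponent `β * x ^ n`. -/
theorem HasDoubleExponentialTail.exists_le_rpow {F : ℝ → ℝ} (hF : HasDoubleExponentialTail F)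
    (m : ℝ) : ∃ C : ℝ, ∀ᶠ x in atTop, 1 - F x ≤ C * x ^ (-m) := by
  obtain ⟨α, β, n, l, H, hα, hβ, hn, hH, hlim⟩ := hF
  refine ⟨2 * α, ?_⟩
  have hdecay : Tendsto (fun x : ℝ => (x ^ n) ^ ((l + m) / n) * Real.exp (-(β / 2) * x ^ n))
      atTop (𝓝 0) :=
    (tendsto_rpow_mul_exp_neg_mul_atTop_nhds_zero ((l + m) / n) (β / 2) (by positivity)).comp
      (tendsto_rpow_atTop hn)
  filter_upwards [hdecay.eventually_le_const one_pos, hlim.eventually_le_const one_lt_two,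
    hH.bound (half_pos hβ), eventually_gt_atTop 0] with x h1 h2 h3 hx
  rw [div_le_iff₀ (by positivity)] at h2
  have hxn : 0 < x ^ n := by positivity
  rw [Real.norm_eq_abs, Real.norm_eq_abs, abs_of_pos hxn] at h3
  have hexp : Real.exp (-β * x ^ n + H x) ≤ Real.exp (-(β / 2) * x ^ n) :=
    Real.exp_le_exp.2 (by linarith [le_abs_self (H x)])
  rw [← Real.rpow_mul hx.le, mul_div_cancel₀ _ hn.ne'] at h1
  calc 1 - F x ≤ 2 * (α * x ^ l * Real.exp (-β * x ^ n + H x)) := h2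
    _ ≤ 2 * (α * x ^ l * Real.exp (-(β / 2) * x ^ n)) := by gcongr
    _ = 2 * α * x ^ (-m) * (x ^ (l + m) * Real.exp (-(β / 2) * x ^ n)) := by
      have : x ^ l = x ^ (-m) * x ^ (l + m) := by rw [← Real.rpow_add hx]; congr 1; ring
      rw [this]; ring
    _ ≤ 2 * α * x ^ (-m) * 1 := by gcongr
    _ = _ := mul_one _

theorem IsClassC.ae_pos {ν : Measure ℝ} [IsProbabilityMeasure ν] (hν : IsClassC (cdf ν)) :
    ∀ᵐ x ∂ν, 0 < x := by
  have h := hν.eq_zero 0 le_rfl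
  rw [cdf_eq_real, measureReal_eq_zero_iff] at h
  rw [ae_iff]
  simpa [Set.Iic] using h

theorem measureReal_Ioi_eq_one_sub_cdf (ν : Measure ℝ) [IsProbabilityMeasure ν] (t : ℝ) :
    ν.real (Set.Ioi t) = 1 - cdf ν t := by
  rw [cdf_eq_real, ← probReal_compl_eq_one_sub measurableSet_Iic, Set.compl_Iic]

theorem IsClassC.lintegral_rpow_lt_top {ν : Measure ℝ} [IsProbabilityMeasure ν]
    (hν : IsClassC (cdf ν)) {s : ℝ} (hs : 0 < s) : ∫⁻ x, ENNReal.ofReal (x ^ s) ∂ν < ∞ := by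
  obtain ⟨C, hC⟩ := hν.tail.exists_le_rpow (s + 1)
  refine lintegral_rpow_lt_top_of_tail ν aemeasurable_id (hν.ae_pos.mono fun x hx => hx.le) hs
    (lt_add_one s) (C := C) ?_
  filter_upwards [hC] with t ht
  rw [← measureReal_Ioi_eq_one_sub_cdf] at ht
  exact ht

/-- The tail of `x⁻¹` at `t` is the CDF near the origin at `t⁻¹`, hence of order `t ^ (-γ)`. -/
theorem lintegral_inv_rpow_lt_top {ν : Measure ℝ} [IsProbabilityMeasure ν]
    (hpos : ∀ᵐ x ∂ν, 0 < x) {η γ : ℝ} (hγ : VariesRegularlyAtZero (cdf ν) η γ)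
    {s : ℝ} (hs : 0 < s) (hsγ : s < γ) : ∫⁻ x, ENNReal.ofReal (x⁻¹ ^ s) ∂ν < ∞ := by
  obtain ⟨hη, -, hlim⟩ := hγ
  refine lintegral_rpow_lt_top_of_tail ν measurable_inv.aemeasurable
    (hpos.mono fun x hx => (inv_pos.2 hx).le) hs hsγ (C := 2 * η) ?_
  filter_upwards [(hlim.comp tendsto_inv_atTop_nhdsGT_zero).eventually_le_const one_lt_two,
    eventually_gt_atTop 0] with t h2 ht
  rw [Function.comp_apply, div_le_iff₀ (by positivity), Real.inv_rpow ht.le,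
    ← Real.rpow_neg ht.le, ← mul_assoc, cdf_eq_real] at h2
  refine le_trans (measureReal_mono fun x hx => ?_) h2
  have hx' : t < x⁻¹ := hx
  have hx0 : 0 < x := inv_pos.1 (ht.trans hx')
  exact (lt_inv_comm₀ ht hx0).1 hx' |>.le

/-! ### Upper bound for full feedback -/

instance (νh νg : Measure ℝ) [IsProbabilityMeasure νh] [IsProbabilityMeasure νg] (N : ℕ) :
    IsProbabilityMeasure (channelLaw νh νg N) := by unfold channelLaw; infer_instance

/-- The deterministic core of the upper bound: up to the total interference, the rate is controlled
by a sum of powers of the ratios `h i / g i`. The parameter `c` is the point at which `log` is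
replaced by its tangent. -/
theorem log_one_add_sum_le {ι : Type*} [Fintype ι] {h g p : ι → ℝ} (hh : ∀ i, 0 < h i)
    (hg : ∀ i, 0 < g i) (hp : ∀ i, 0 ≤ p i) {s c : ℝ} (hs : 0 < s) (hc : 0 < c) :
    Real.log (1 + ∑ i, h i * p i) ≤
      s⁻¹ * (Real.log c + c⁻¹ * (1 + ∑ i, h i ^ s * (g i)⁻¹ ^ s)) + ∑ i, g i * p i := by
  set W := 1 + ∑ i, h i ^ s * (g i)⁻¹ ^ s
  set S := ∑ i, g i * p i
  have hterm : ∀ i, 0 ≤ h i ^ s * (g i)⁻¹ ^ s := fun i => by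
    have := hh i; have := hg i; positivity
  have hW : 1 ≤ W := le_add_of_nonneg_right (Finset.sum_nonneg fun i _ => hterm i)
  have hS : 0 ≤ S := Finset.sum_nonneg fun i _ => mul_nonneg (hg i).le (hp i)
  have hW1 : 1 ≤ W ^ s⁻¹ := Real.one_le_rpow hW (by positivity)
  have hratio : ∀ i, h i ≤ W ^ s⁻¹ * g i := fun i => by
    have h1 : (h i * (g i)⁻¹) ^ s ≤ W := by
      rw [Real.mul_rpow (hh i).le (inv_pos.2 (hg i)).le]
      have := Finset.single_le_sum (fun j _ => hterm j) (Finset.mem_univ i)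
      exact this.trans (le_add_of_nonneg_left zero_le_one)
    have h0 : 0 ≤ h i * (g i)⁻¹ := mul_nonneg (hh i).le (inv_pos.2 (hg i)).le
    have h2 := Real.rpow_le_rpow (by positivity) h1 (inv_pos.2 hs).le
    rw [Real.rpow_rpow_inv h0 hs.ne'] at h2
    rwa [← div_eq_mul_inv, div_le_iff₀ (hg i)] at h2
  have hsum : ∑ i, h i * p i ≤ W ^ s⁻¹ * S := by
    rw [Finset.mul_sum]
    refine Finset.sum_le_sum fun i _ => ?_
    rw [← mul_assoc]
    exact mul_le_mul_of_nonneg_right (hratio i) (hp i)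
  have hpos : 0 ≤ ∑ i, h i * p i := Finset.sum_nonneg fun i _ => mul_nonneg (hh i).le (hp i)
  have hlogW : Real.log W ≤ Real.log c + c⁻¹ * W := by
    have h1 := Real.log_le_sub_one_of_pos (x := c⁻¹ * W) (by positivity)
    rw [Real.log_mul (by positivity) (by positivity), Real.log_inv] at h1
    linarith
  calc Real.log (1 + ∑ i, h i * p i) ≤ Real.log (W ^ s⁻¹ * (1 + S)) :=
        Real.log_le_log (by positivity) (by linarith)
    _ = s⁻¹ * Real.log W + Real.log (1 + S) := by
        rw [Real.log_mul (by positivity) (by positivity), Real.log_rpow (by positivity)]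
    _ ≤ s⁻¹ * (Real.log c + c⁻¹ * W) + S := by
        have := Real.log_le_sub_one_of_pos (x := 1 + S) (by positivity)
        gcongr
        linarith

theorem channelLaw_ae_pos {νh νg : Measure ℝ} [IsProbabilityMeasure νh] [IsProbabilityMeasure νg]
    (hh : ∀ᵐ x ∂νh, 0 < x) (hg : ∀ᵐ x ∂νg, 0 < x) (N : ℕ) :
    ∀ᵐ ω ∂channelLaw νh νg N, (∀ i, 0 < ω.1 i) ∧ ∀ i, 0 < ω.2 i := by
  have key : ∀ ν : Measure ℝ, IsProbabilityMeasure ν → (∀ᵐ x ∂ν, 0 < x) →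
      ∀ᵐ v ∂Measure.pi fun _ : Fin N => ν, ∀ i, 0 < v i := fun ν _ hν =>
    ae_all_iff.2 fun i =>
      (measurePreserving_eval (fun _ : Fin N => ν) i).quasiMeasurePreserving.ae hν
  have h1 : ∀ᵐ ω ∂channelLaw νh νg N, ∀ i, 0 < ω.1 i :=
    Measure.quasiMeasurePreserving_fst.ae (key νh inferInstance hh)
  have h2 : ∀ᵐ ω ∂channelLaw νh νg N, ∀ i, 0 < ω.2 i :=
    Measure.quasiMeasurePreserving_snd.ae (key νg inferInstance hg)
  exact h1.and h2

theorem lintegral_channelLaw_mul (νh νg : Measure ℝ) [IsProbabilityMeasure νh]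
    [IsProbabilityMeasure νg] {N : ℕ} (i : Fin N) {u v : ℝ → ℝ≥0∞} (hu : Measurable u)
    (hv : Measurable v) :
    ∫⁻ ω, u (ω.1 i) * v (ω.2 i) ∂channelLaw νh νg N = (∫⁻ x, u x ∂νh) * ∫⁻ x, v x ∂νg := by
  rw [channelLaw, lintegral_prod_mul (f := fun a : Fin N → ℝ => u (a i))
    (g := fun a : Fin N → ℝ => v (a i)) (hu.comp (measurable_pi_apply i)).aemeasurable
    (hv.comp (measurable_pi_apply i)).aemeasurable,
    (measurePreserving_eval (fun _ : Fin N => νh) i).lintegral_comp hu,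
    (measurePreserving_eval (fun _ : Fin N => νg) i).lintegral_comp hv]

/-- The constant `C` does not depend on `N`, so the sum-rate is at most `s⁻¹ * log N + O(1)`. -/
theorem exists_sumRateFull_le {νh νg : Measure ℝ} [IsProbabilityMeasure νh]
    [IsProbabilityMeasure νg] (hh : IsClassC (cdf νh)) (hg : IsClassC (cdf νg)) {η γ : ℝ}
    (hγ : VariesRegularlyAtZero (cdf νg) η γ) {s : ℝ} (hs : 0 < s) (hsγ : s < γ)
    {Q : ℝ} (hQ : 0 < Q) :
    ∃ C : ℝ, ∀ N : ℕ,
      sumRateFull νh νg Q N ≤ ENNReal.ofReal (s⁻¹ * (Real.log (N + 1) + C) + Q) := by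
  set A := ∫⁻ x, ENNReal.ofReal (x ^ s) ∂νh
  set B := ∫⁻ x, ENNReal.ofReal (x⁻¹ ^ s) ∂νg
  have hAB : A * B ≠ ∞ := (ENNReal.mul_lt_top (hh.lintegral_rpow_lt_top hs)
    (lintegral_inv_rpow_lt_top hg.ae_pos hγ hs hsγ)).ne
  set M := (A * B).toReal
  have hM : 0 ≤ M := ENNReal.toReal_nonneg
  refine ⟨1 + M, fun N => iSup₂_le fun P hP => ?_⟩
  have hN : (0 : ℝ) < N + 1 := by positivity
  have hlogN : 0 ≤ Real.log (N + 1) := Real.log_nonneg (by linarith [N.cast_nonneg (α := ℝ)])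
  -- The tangent point has the order of the mean `1 + N * M` of `W`, and is positive also for `N = 0`.
  let c : ℝ := N + 1
  have hc : 0 < c := hN
  have hmom : ∫⁻ ω, ∑ i, ENNReal.ofReal (ω.1 i ^ s) * ENNReal.ofReal ((ω.2 i)⁻¹ ^ s)
      ∂channelLaw νh νg N = ENNReal.ofReal (N * M) := by
    rw [lintegral_finsetSum _ (fun i _ => by fun_prop)]
    rw [Finset.sum_congr rfl fun i _ => lintegral_channelLaw_mul νh νg i
      (u := fun x => ENNReal.ofReal (x ^ s)) (v := fun x => ENNReal.ofReal (x⁻¹ ^ s))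
      (by fun_prop) (by fun_prop)]
    rw [Finset.sum_const, Finset.card_univ, Fintype.card_fin, nsmul_eq_mul,
      ENNReal.ofReal_mul (by positivity), ENNReal.ofReal_natCast, ENNReal.ofReal_toReal hAB]
  have hpt : ∀ᵐ ω ∂channelLaw νh νg N,
      ENNReal.ofReal (Real.log (1 + ∑ i, ω.1 i * P ω i)) ≤
        ENNReal.ofReal (s⁻¹ * (Real.log c + c⁻¹)) + ENNReal.ofReal (s⁻¹ * c⁻¹) *
          (∑ i, ENNReal.ofReal (ω.1 i ^ s) * ENNReal.ofReal ((ω.2 i)⁻¹ ^ s)) +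
          ENNReal.ofReal (∑ i, ω.2 i * P ω i) := by
    filter_upwards [channelLaw_ae_pos hh.ae_pos hg.ae_pos N] with ω hω
    have hterm : ∀ i, 0 ≤ ω.1 i ^ s * (ω.2 i)⁻¹ ^ s := fun i => by
      have := hω.1 i; have := hω.2 i; positivity
    have hsum : ∑ i, ENNReal.ofReal (ω.1 i ^ s) * ENNReal.ofReal ((ω.2 i)⁻¹ ^ s) =
        ENNReal.ofReal (∑ i, ω.1 i ^ s * (ω.2 i)⁻¹ ^ s) := by
      rw [ENNReal.ofReal_sum_of_nonneg fun i _ => hterm i]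
      exact Finset.sum_congr rfl fun i _ =>
        (ENNReal.ofReal_mul (Real.rpow_nonneg (hω.1 i).le s)).symm
    have hsum0 : 0 ≤ ∑ i, ω.1 i ^ s * (ω.2 i)⁻¹ ^ s := Finset.sum_nonneg fun i _ => hterm i
    have hS : 0 ≤ ∑ i, ω.2 i * P ω i :=
      Finset.sum_nonneg fun i _ => mul_nonneg (hω.2 i).le (hP.nonneg ω i)
    have hlogc : 0 ≤ Real.log c := hlogN
    rw [hsum, ← ENNReal.ofReal_mul (by positivity), ← ENNReal.ofReal_add (by positivity)
      (by positivity), ← ENNReal.ofReal_add (by positivity) hS]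
    refine ENNReal.ofReal_le_ofReal
      ((log_one_add_sum_le hω.1 hω.2 (hP.nonneg ω) hs hc).trans_eq ?_)
    ring
  calc expectedRate νh νg P
      ≤ ENNReal.ofReal (s⁻¹ * (Real.log c + c⁻¹)) + ENNReal.ofReal (s⁻¹ * c⁻¹) *
          ENNReal.ofReal (N * M) + avgInterference νh νg P := by
        refine (lintegral_mono_ae hpt).trans_eq ?_
        rw [lintegral_add_left (by fun_prop), lintegral_add_left measurable_const, lintegral_const,
          lintegral_const_mul _ (by fun_prop), hmom, measure_univ, mul_one]
        rfl
    _ ≤ ENNReal.ofReal (s⁻¹ * (Real.log c + c⁻¹)) + ENNReal.ofReal (s⁻¹ * c⁻¹) *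
          ENNReal.ofReal (N * M) + ENNReal.ofReal Q := by gcongr; exact hP.interference
    _ = ENNReal.ofReal (s⁻¹ * (Real.log c + (c⁻¹ + c⁻¹ * (N * M))) + Q) := by
        have hlogc : 0 ≤ Real.log c := hlogN
        rw [← ENNReal.ofReal_mul (by positivity), ← ENNReal.ofReal_add (by positivity)
          (by positivity), ← ENNReal.ofReal_add (by positivity) hQ.le]
        congr 1; ring
    _ ≤ ENNReal.ofReal (s⁻¹ * (Real.log (N + 1) + (1 + M)) + Q) := by
        refine ENNReal.ofReal_le_ofReal ?_
        have hc1 : c⁻¹ ≤ 1 := inv_le_one_of_one_le₀ (by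
          have := N.cast_nonneg (α := ℝ)
          simp only [c]; linarith)
        have hc2 : c⁻¹ * (N * M) ≤ M := by
          rw [← mul_assoc]
          refine mul_le_of_le_one_left hM ?_
          rw [inv_mul_le_iff₀ hc, mul_one]
          simp only [c]; linarith
        gcongr

/-! ### Serving the user of smallest interference gain -/

/-- `i` is the first index at which `g` attains its minimum. Breaking ties by the index makes
such an `i` unique for every `g`, not only almost surely. -/
def IsFirstArgmin {N : ℕ} (g : Fin N → ℝ) (i : Fin N) : Prop :=
  ∀ j, g i ≤ g j ∧ (j < i → g i < g j)

theorem IsFirstArgmin.unique {N : ℕ} {g : Fin N → ℝ} {i j : Fin N} (hi : IsFirstArgmin g i)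
    (hj : IsFirstArgmin g j) : i = j := by
  rcases lt_trichotomy i j with h | h | h
  · exact absurd (hi j).1 (not_le.2 ((hj i).2 h))
  · exact h
  · exact absurd (hj i).1 (not_le.2 ((hi j).2 h))

theorem exists_isFirstArgmin {N : ℕ} [NeZero N] (g : Fin N → ℝ) : ∃ i, IsFirstArgmin g i := by
  obtain ⟨i₀, -, hi₀⟩ := Finset.exists_min_image Finset.univ g Finset.univ_nonempty
  obtain ⟨i, hi, hmin⟩ := Finset.exists_min_image
    (Finset.univ.filter fun i => g i = g i₀) id ⟨i₀, by simp⟩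
  simp only [Finset.mem_filter, Finset.mem_univ, true_and, id, true_imp_iff] at hi hmin hi₀
  refine ⟨i, fun j => ⟨hi ▸ hi₀ j, fun hj => ?_⟩⟩
  rw [hi]
  exact lt_of_le_of_ne (hi₀ j) fun h => absurd (hmin j h.symm) (not_le.2 hj)

theorem measurableSet_isFirstArgmin {N : ℕ} (i : Fin N) :
    MeasurableSet {g : Fin N → ℝ | IsFirstArgmin g i} := by
  simp only [IsFirstArgmin, Set.ofPred_forall, Set.ofPred_and]
  refine MeasurableSet.iInter fun j => (measurableSet_le (by fun_prop) (by fun_prop)).inter ?_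
  exact MeasurableSet.iInter fun _ => measurableSet_lt (by fun_prop) (by fun_prop)

open Classical in
/-- The policy that spends the whole interference budget `Q` on the first user with the smallest
gain to the primary base station. The absolute value keeps the power nonnegative on the null event
that this gain is negative. -/
noncomputable def minGainPolicy (Q : ℝ) (N : ℕ) : PowerPolicy N :=
  fun ω i => if IsFirstArgmin ω.2 i then Q / |ω.2 i| else 0

theorem sum_mul_minGainPolicy (Q : ℝ) {N : ℕ} (ω : (Fin N → ℝ) × (Fin N → ℝ)) (a : Fin N → ℝ)
    {i : Fin N} (hi : IsFirstArgmin ω.2 i) :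
    ∑ j, a j * minGainPolicy Q N ω j = a i * (Q / |ω.2 i|) := by
  rw [Finset.sum_eq_single i]
  · simp [minGainPolicy, hi]
  · intro j _ hj
    have : ¬ IsFirstArgmin ω.2 j := fun h => hj (h.unique hi)
    simp [minGainPolicy, this]
  · simp

theorem isILFeasible_minGainPolicy (νh νg : Measure ℝ) [IsProbabilityMeasure νh]
    [IsProbabilityMeasure νg] {Q : ℝ} (hQ : 0 < Q) (N : ℕ) :
    IsILFeasible νh νg Q (minGainPolicy Q N) where
  measurable := measurable_pi_lambda _ fun i => by
    refine Measurable.ite (measurable_snd (measurableSet_isFirstArgmin i)) ?_ measurable_const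
    fun_prop
  nonneg ω i := by
    unfold minGainPolicy
    split_ifs <;> positivity
  interference := by
    have hle : ∀ ω : (Fin N → ℝ) × (Fin N → ℝ), ∑ i, ω.2 i * minGainPolicy Q N ω i ≤ Q := by
      intro ω
      rcases N.eq_zero_or_pos with rfl | hN
      · simpa using hQ.le
      have : NeZero N := ⟨hN.ne'⟩
      obtain ⟨i, hi⟩ := exists_isFirstArgmin ω.2
      rw [sum_mul_minGainPolicy Q ω ω.2 hi, mul_div_left_comm]
      refine mul_le_of_le_one_right hQ.le (div_le_one_of_le₀ (le_abs_self _) (abs_nonneg _))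
    calc avgInterference νh νg (minGainPolicy Q N)
        ≤ ∫⁻ _, ENNReal.ofReal Q ∂channelLaw νh νg N :=
          lintegral_mono fun ω => ENNReal.ofReal_le_ofReal (hle ω)
      _ = ENNReal.ofReal Q := by simp

theorem satisfiesFeedback_minGainPolicy (Q : ℝ) {N K : ℕ} (hK : K ≤ N) :
    SatisfiesFeedback K (minGainPolicy Q N) := by
  intro ω i hi
  -- Out of this range `kthSmallest` is a default value; in it, `kthSmallest` is one of the gains.
  have hK' : K - 1 < N := by have := i.pos; omega
  rw [kthSmallest, dif_pos hK'] at hi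
  exact if_neg fun h => absurd (h _).1 (not_le.2 hi)

/-- The probability that the smallest of `N` i.i.d. variables is at most `t`. -/
theorem pi_exists_le_eq (ν : Measure ℝ) [IsProbabilityMeasure ν] (N : ℕ) (t : ℝ) :
    (Measure.pi fun _ : Fin N => ν) {g | ∃ i, g i ≤ t} =
      ENNReal.ofReal (1 - (1 - cdf ν t) ^ N) := by
  have hset : {g : Fin N → ℝ | ∃ i, g i ≤ t} = (Set.univ.pi fun _ => Set.Ioi t)ᶜ := by
    ext g; simp
  rw [hset, prob_compl_eq_one_sub (MeasurableSet.univ_pi fun _ => measurableSet_Ioi),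
    Measure.pi_pi, Finset.prod_const, Finset.card_univ, Fintype.card_fin,
    ← ofReal_measureReal, measureReal_Ioi_eq_one_sub_cdf,
    ← ENNReal.ofReal_pow (sub_nonneg.2 (cdf_le_one ν t)),
    ENNReal.ofReal_sub _ (pow_nonneg (sub_nonneg.2 (cdf_le_one ν t)) N), ENNReal.ofReal_one]

/-- The rate of `minGainPolicy`, bounded below on the event that the served user has `h i > c` and
`g i ≤ t`. -/
theorem le_sumRateKSCG {νh νg : Measure ℝ} [IsProbabilityMeasure νh] [IsProbabilityMeasure νg]
    (hg : ∀ᵐ x ∂νg, 0 < x) {Q : ℝ} (hQ : 0 < Q) {N K : ℕ} [NeZero N] (hK : K ≤ N)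
    {c t : ℝ} (hc : 0 < c) (ht : 0 < t) :
    ENNReal.ofReal (Real.log (1 + Q * c / t) * (1 - cdf νh c) * (1 - (1 - cdf νg t) ^ N)) ≤
      sumRateKSCG νh νg Q N K := by
  refine le_trans ?_ (le_iSup₂ (f := fun (P : PowerPolicy N)
    (_ : IsILFeasible νh νg Q P ∧ SatisfiesFeedback K P) => expectedRate νh νg P)
    (minGainPolicy Q N) ⟨isILFeasible_minGainPolicy νh νg hQ N,
      satisfiesFeedback_minGainPolicy Q hK⟩)
  set L := Real.log (1 + Q * c / t)
  have hL : 0 ≤ L := Real.log_nonneg (by have : 0 < Q * c / t := by positivity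
                                         linarith)
  have hp : 0 ≤ 1 - cdf νh c := sub_nonneg.2 (cdf_le_one νh c)
  have hmeas : Measurable fun ω : (Fin N → ℝ) × (Fin N → ℝ) =>
      ENNReal.ofReal (Real.log (1 + ∑ i, ω.1 i * minGainPolicy Q N ω i)) := by
    have hP : ∀ i, Measurable fun ω => minGainPolicy Q N ω i := fun i =>
      (measurable_pi_apply i).comp (isILFeasible_minGainPolicy νh νg hQ N).measurable
    fun_prop
  have hgpos : ∀ᵐ g ∂Measure.pi fun _ : Fin N => νg, ∀ i, 0 < g i := ae_all_iff.2 fun i =>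
    (measurePreserving_eval (fun _ : Fin N => νg) i).quasiMeasurePreserving.ae hg
  have hE : MeasurableSet {g : Fin N → ℝ | ∃ i, g i ≤ t} := by
    rw [Set.ofPred_exists]
    exact MeasurableSet.iUnion fun i => measurableSet_le (by fun_prop) (by fun_prop)
  -- Integrating over `h` first, with `g` fixed, the index `i` of the served user does not depend
  -- on `h`, so that `h i` has law `νh`.
  rw [expectedRate, channelLaw, lintegral_prod_symm' _ hmeas, ENNReal.ofReal_mul (by positivity),
    ← pi_exists_le_eq, ← lintegral_indicator_const hE]
  refine lintegral_mono_ae ?_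
  filter_upwards [hgpos] with g hgp
  refine Set.indicator_apply_le' (fun hgE => ?_) (fun _ => zero_le)
  obtain ⟨j, hj⟩ := hgE
  obtain ⟨i, hi⟩ := exists_isFirstArgmin g
  have hit : g i ≤ t := (hi j).1.trans hj
  have hcyl : (Measure.pi fun _ : Fin N => νh) {h | c < h i} = ENNReal.ofReal (1 - cdf νh c) := by
    rw [← measureReal_Ioi_eq_one_sub_cdf, ofReal_measureReal]
    exact (measurePreserving_eval (fun _ : Fin N => νh) i).measure_preimage
      measurableSet_Ioi.nullMeasurableSet
  rw [ENNReal.ofReal_mul hL, ← hcyl,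
    ← lintegral_indicator_const (measurableSet_lt (by fun_prop) (by fun_prop))]
  refine lintegral_mono fun h => Set.indicator_apply_le' (fun hh => ?_) (fun _ => zero_le)
  have hh' : c < h i := hh
  have hhi : 0 < h i := hc.trans hh'
  rw [sum_mul_minGainPolicy Q (h, g) h hi, abs_of_pos (hgp i)]
  refine ENNReal.ofReal_le_ofReal (Real.log_le_log (by positivity) ?_)
  have := hgp i
  rw [mul_comm Q c, mul_div_assoc]
  gcongr

/-! ### Asymptotics -/

theorem tendsto_log_natCast_atTop : Tendsto (fun N : ℕ => Real.log N) atTop atTop :=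
  Real.tendsto_log_atTop.comp tendsto_natCast_atTop_atTop

theorem sumRateKSCG_le_sumRateFull (νh νg : Measure ℝ) (Q : ℝ) (N K : ℕ) :
    sumRateKSCG νh νg Q N K ≤ sumRateFull νh νg Q N :=
  iSup₂_le fun P hP => le_iSup₂ (f := fun (P : PowerPolicy N) (_ : IsILFeasible νh νg Q P) =>
    expectedRate νh νg P) P hP.1

theorem sumRateFull_ne_top {νh νg : Measure ℝ} [IsProbabilityMeasure νh]
    [IsProbabilityMeasure νg] (hh : IsClassC (cdf νh)) (hg : IsClassC (cdf νg)) {Q : ℝ}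
    (hQ : 0 < Q) (N : ℕ) : sumRateFull νh νg Q N ≠ ∞ := by
  obtain ⟨η, γ, hγ⟩ := hg.origin
  obtain ⟨C, hC⟩ := exists_sumRateFull_le hh hg hγ (half_pos hγ.2.1) (half_lt_self hγ.2.1) hQ
  exact ((hC N).trans_lt ENNReal.ofReal_lt_top).ne

theorem eventually_sumRateFull_div_log_lt {νh νg : Measure ℝ} [IsProbabilityMeasure νh]
    [IsProbabilityMeasure νg] (hh : IsClassC (cdf νh)) (hg : IsClassC (cdf νg)) {η γ : ℝ}
    (hγ : VariesRegularlyAtZero (cdf νg) η γ) {Q : ℝ} (hQ : 0 < Q) {b : ℝ} (hb : 1 / γ < b) :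
    ∀ᶠ N : ℕ in atTop, (sumRateFull νh νg Q N).toReal / Real.log N < b := by
  have hγ0 : 0 < γ := hγ.2.1
  have hb0 : 0 < b := (one_div_pos.2 hγ0).trans hb
  obtain ⟨s, hbs, hsγ⟩ := exists_between ((one_div_lt hγ0 hb0).1 hb)
  have hs : 0 < s := (one_div_pos.2 hb0).trans hbs
  obtain ⟨C, hC⟩ := exists_sumRateFull_le hh hg hγ hs hsγ hQ
  have hlim : Tendsto (fun N : ℕ => s⁻¹ * (1 + (Real.log (N + 1) - Real.log N) / Real.log N +
      C / Real.log N) + Q / Real.log N) atTop (𝓝 (s⁻¹ * (1 + 0 + 0) + 0)) :=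
    (((tendsto_const_nhds.add (Real.tendsto_log_nat_add_one_sub_log.div_atTop
      tendsto_log_natCast_atTop)).add (tendsto_log_natCast_atTop.const_div_atTop C)).const_mul
        s⁻¹).add (tendsto_log_natCast_atTop.const_div_atTop Q)
  have hsb : s⁻¹ * (1 + 0 + 0) + 0 < b := by
    rw [add_zero, add_zero, add_zero, mul_one, ← one_div]
    exact (one_div_lt hb0 hs).1 hbs
  have hlogC : Tendsto (fun N : ℕ => Real.log N + C) atTop atTop :=
    tendsto_atTop_add_const_right _ _ tendsto_log_natCast_atTop
  filter_upwards [hlim.eventually_lt_const hsb, tendsto_log_natCast_atTop.eventually_gt_atTop 0,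
    hlogC.eventually_ge_atTop 0, eventually_ge_atTop 1] with N hN hlog hNC hN1
  refine lt_of_le_of_lt ?_ hN
  have hN1' : (1 : ℝ) ≤ N := by exact_mod_cast hN1
  have hmono : Real.log N ≤ Real.log (N + 1) := Real.log_le_log (by linarith) (by linarith)
  have hnonneg : 0 ≤ s⁻¹ * (Real.log (N + 1) + C) + Q := by
    have : 0 ≤ Real.log (N + 1) + C := by linarith
    positivity
  rw [div_le_iff₀ hlog]
  refine (ENNReal.toReal_le_of_le_ofReal hnonneg (hC N)).trans_eq ?_
  field_simp
  ring

/-- The probability that all of `N` i.i.d. gains exceed `N ^ (-a)` vanishes for `a < 1 / γ`, since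
`N * F (N ^ (-a))` is of order `N ^ (1 - a * γ)`. -/
theorem tendsto_one_sub_cdf_rpow_pow {ν : Measure ℝ} [IsProbabilityMeasure ν] {η γ : ℝ}
    (hγ : VariesRegularlyAtZero (cdf ν) η γ) {a : ℝ} (ha : 0 < a) (haγ : a * γ < 1) :
    Tendsto (fun N : ℕ => (1 - cdf ν ((N : ℝ) ^ (-a))) ^ N) atTop (𝓝 0) := by
  obtain ⟨hη, -, hlim⟩ := hγ
  have ht0 : Tendsto (fun N : ℕ => (N : ℝ) ^ (-a)) atTop (𝓝[>] 0) := by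
    refine tendsto_nhdsWithin_iff.2
      ⟨(tendsto_rpow_neg_atTop ha).comp tendsto_natCast_atTop_atTop, ?_⟩
    filter_upwards [eventually_gt_atTop 0] with N hN
    exact Real.rpow_pos_of_pos (by exact_mod_cast hN) _
  have hexp : Tendsto (fun N : ℕ => Real.exp (-(η / 2 * (N : ℝ) ^ (1 - a * γ)))) atTop (𝓝 0) :=
    Real.tendsto_exp_neg_atTop_nhds_zero.comp (Tendsto.const_mul_atTop (half_pos hη)
      ((tendsto_rpow_atTop (sub_pos.2 haγ)).comp tendsto_natCast_atTop_atTop))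
  refine tendsto_of_tendsto_of_tendsto_of_le_of_le' tendsto_const_nhds hexp
    (Eventually.of_forall fun N => pow_nonneg (sub_nonneg.2 (cdf_le_one ν _)) N) ?_
  filter_upwards [(hlim.comp ht0).eventually_const_le (show (1 / 2 : ℝ) < 1 by norm_num),
    eventually_gt_atTop 0] with N hhalf hN
  have hN' : (0 : ℝ) < N := by exact_mod_cast hN
  rw [Function.comp_apply, le_div_iff₀ (by positivity), ← Real.rpow_mul hN'.le] at hhalf
  calc (1 - cdf ν ((N : ℝ) ^ (-a))) ^ N
      ≤ Real.exp (-cdf ν ((N : ℝ) ^ (-a))) ^ N := by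
        gcongr
        · exact sub_nonneg.2 (cdf_le_one ν _)
        · exact Real.one_sub_le_exp_neg _
    _ = Real.exp (-(N * cdf ν ((N : ℝ) ^ (-a)))) := by rw [← Real.exp_nat_mul, mul_neg]
    _ ≤ Real.exp (-(η / 2 * (N : ℝ) ^ (1 - a * γ))) := by
        refine Real.exp_le_exp.2 (neg_le_neg ?_)
        calc η / 2 * (N : ℝ) ^ (1 - a * γ) = N * (1 / 2 * (η * (N : ℝ) ^ (-a * γ))) := by
              rw [sub_eq_add_neg, Real.rpow_add hN', Real.rpow_one, neg_mul]; ring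
          _ ≤ _ := by gcongr

theorem eventually_lt_sumRateKSCG_div_log {νh νg : Measure ℝ} [IsProbabilityMeasure νh]
    [IsProbabilityMeasure νg] (hh : IsClassC (cdf νh)) (hg : IsClassC (cdf νg)) {η γ : ℝ}
    (hγ : VariesRegularlyAtZero (cdf νg) η γ) {Q : ℝ} (hQ : 0 < Q) {K : ℕ → ℕ}
    (hK : ∀ N, 1 ≤ N → K N ≤ N) {r : ℝ} (hr : r < 1 / γ) :
    ∀ᶠ N : ℕ in atTop, r < (sumRateKSCG νh νg Q N (K N)).toReal / Real.log N := by
  have hγ0 : 0 < γ := hγ.2.1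
  obtain ⟨a, hra, haγ⟩ := exists_between (max_lt hr (one_div_pos.2 hγ0))
  obtain ⟨hra, ha⟩ := max_lt_iff.1 hra
  rw [lt_div_iff₀ hγ0] at haγ
  -- `P(h > c)` tends to `1` as `c ↓ 0`, since the CDF of `h` is continuous and vanishes at `0`.
  obtain ⟨c, hrc, hc⟩ : ∃ c : ℝ, r < a * (1 - cdf νh c) ∧ 0 < c := by
    have hcont : Tendsto (fun c : ℝ => a * (1 - cdf νh c)) (𝓝[>] 0) (𝓝 a) := by
      have := hh.continuous
      have h0 : Tendsto (fun c : ℝ => a * (1 - cdf νh c)) (𝓝 0) (𝓝 (a * (1 - cdf νh 0))) :=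
        Continuous.tendsto (by fun_prop) 0
      rw [hh.eq_zero 0 le_rfl, sub_zero, mul_one] at h0
      exact h0.mono_left nhdsWithin_le_nhds
    exact ((hcont.eventually_const_lt hra).and self_mem_nhdsWithin).exists
  have hlim : Tendsto (fun N : ℕ => (Real.log (Q * c) / Real.log N + a) * (1 - cdf νh c) *
      (1 - (1 - cdf νg ((N : ℝ) ^ (-a))) ^ N)) atTop
      (𝓝 ((0 + a) * (1 - cdf νh c) * (1 - 0))) :=
    (((tendsto_log_natCast_atTop.const_div_atTop _).add_const a).mul_const _).mul
      (tendsto_const_nhds.sub (tendsto_one_sub_cdf_rpow_pow hγ ha haγ))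
  rw [zero_add, sub_zero, mul_one] at hlim
  filter_upwards [hlim.eventually_const_lt hrc, tendsto_log_natCast_atTop.eventually_gt_atTop 0,
    eventually_ge_atTop 1] with N hN hlog hN1
  have hN0 : (0 : ℝ) < N := by exact_mod_cast hN1
  have : NeZero N := ⟨by omega⟩
  have ht : 0 < (N : ℝ) ^ (-a) := Real.rpow_pos_of_pos hN0 _
  have hrate := le_sumRateKSCG (νh := νh) hg.ae_pos hQ (hK N hN1) hc ht
  have hp : 0 ≤ 1 - cdf νh c := sub_nonneg.2 (cdf_le_one νh c)
  have hq : 0 ≤ 1 - (1 - cdf νg ((N : ℝ) ^ (-a))) ^ N :=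
    sub_nonneg.2 (pow_le_one₀ (sub_nonneg.2 (cdf_le_one νg _))
      (sub_le_self _ (cdf_nonneg νg _)))
  have hlogle : Real.log (Q * c) + a * Real.log N ≤ Real.log (1 + Q * c / (N : ℝ) ^ (-a)) := by
    rw [Real.rpow_neg hN0.le, div_inv_eq_mul, ← Real.log_rpow hN0,
      ← Real.log_mul (by positivity) (by positivity)]
    exact Real.log_le_log (by positivity) (by linarith)
  refine hN.trans_le ?_
  rw [le_div_iff₀ hlog]
  refine le_trans ?_ ((ENNReal.ofReal_le_iff_le_toReal (ne_top_of_le_ne_top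
    (sumRateFull_ne_top hh hg hQ N) (sumRateKSCG_le_sumRateFull νh νg Q N (K N)))).1 hrate)
  calc (Real.log (Q * c) / Real.log N + a) * (1 - cdf νh c) *
        (1 - (1 - cdf νg ((N : ℝ) ^ (-a))) ^ N) * Real.log N
      = (Real.log (Q * c) + a * Real.log N) * (1 - cdf νh c) *
        (1 - (1 - cdf νg ((N : ℝ) ^ (-a))) ^ N) := by field_simp
    _ ≤ _ := by gcongr

theorem theorem3 (νh νg : Measure ℝ) [IsProbabilityMeasure νh] [IsProbabilityMeasure νg]
    (hh : IsClassC (cdf νh)) (hg : IsClassC (cdf νg))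
    (ηg γg : ℝ) (hγ : VariesRegularlyAtZero (cdf νg) ηg γg)
    (Q : ℝ) (hQ : 0 < Q)
    (K : ℕ → ℕ) (hK : ∀ N : ℕ, 1 ≤ N → 0 < K N ∧ K N ≤ N) :
    (∀ N : ℕ, sumRateFull νh νg Q N ≠ ∞) ∧
    (∀ N : ℕ, sumRateKSCG νh νg Q N (K N) ≠ ∞) ∧
    Tendsto (fun N : ℕ => (sumRateFull νh νg Q N).toReal / Real.log N) atTop (𝓝 (1 / γg)) ∧
    Tendsto (fun N : ℕ => (sumRateKSCG νh νg Q N (K N)).toReal / Real.log N) atTop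
      (𝓝 (1 / γg)) := by
  have hfin : ∀ N, sumRateFull νh νg Q N ≠ ∞ := sumRateFull_ne_top hh hg hQ
  have hle : ∀ N : ℕ, (sumRateKSCG νh νg Q N (K N)).toReal / Real.log N ≤
      (sumRateFull νh νg Q N).toReal / Real.log N := fun N =>
    div_le_div_of_nonneg_right (ENNReal.toReal_mono (hfin N)
      (sumRateKSCG_le_sumRateFull νh νg Q N (K N))) (Real.log_natCast_nonneg N)
  have hlower : ∀ r < 1 / γg, ∀ᶠ N : ℕ in atTop,
      r < (sumRateKSCG νh νg Q N (K N)).toReal / Real.log N := fun r hr =>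
    eventually_lt_sumRateKSCG_div_log hh hg hγ hQ (fun N hN => (hK N hN).2) hr
  have hupper : ∀ b > 1 / γg, ∀ᶠ N : ℕ in atTop,
      (sumRateFull νh νg Q N).toReal / Real.log N < b := fun b hb =>
    eventually_sumRateFull_div_log_lt hh hg hγ hQ hb
  exact ⟨hfin,
    fun N => ne_top_of_le_ne_top (hfin N) (sumRateKSCG_le_sumRateFull νh νg Q N (K N)),
    tendsto_order.2 ⟨fun r hr => (hlower r hr).mono fun N hN => hN.trans_le (hle N), hupper⟩,
    tendsto_order.2 ⟨hlower, fun b hb => (hupper b hb).mono fun N hN => (hle N).trans_lt hN⟩⟩
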